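/- **Setting.** For an integer $b\ge 2$ let $\mathfrak S_b$ be the set of permutations of $\{0,\dots,b-1\}$. For $n\ge 0$ let $a_j(n)$ be the $j$-th digit of $n$ in base $b$, so that $n=\sum_{j\ge 0}a_j(n)b^j$. For $\sigma\in\mathfrak S_b$ put $$S_b^\sigma(n)=\sum_{j=0}^\infty \frac{\sigma(a_j(n))}{b^{j+1}},\qquad \mathcal S_b^\sigma=(S_b^\sigma(n))_{n\ge 0},$$ and let $\mathcal S_2=\mathcal S_2^{\mathrm{id}}$ be the classical binary van der Corput sequence. Writing permutations as tuples of values, define $\mathcal P_1=\{(0,1)\}$, and let $\mathcal P_{m+1}\subset\mathfrak S_{2^{m+1}}$ consist of all concatenations $(2\sigma,\,2\sigma'\oplus a)$ with $\sigma,\sigma'\in\mathcal P_m$ and $a$ odd, $1\le a\le 2^{m+1}$, where $2\sigma'\oplus a$ is obtained from $2\sigma'$ by adding $a$ to every entry modulo $2^{m+1}$. For a sequence $X=(x_n)_{n\ge 0}$ and $N\ge 1$ put $$D_N(X)=\sup_{0\le\alpha<\beta<1}\left|\frac{\#\{0\le i\le N-1:\alpha\le x_i<\beta\}}{N}-(\beta-\alpha)\right|.$$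 **Theorem (Counting in Binary).** Let $f:[0,1]\to(-\infty,+\infty]$ be finite on $(0,1)$ (the value $+\infty$ is allowed at the endpoints), with $f(x)=f(1-x)$ for $x\in[0,1]$, twice differentiable on $(0,1)$ with $f''(x)>0$ for all $x\in(0,1)$, and convex on the closed interval $[0,1]$ (which only means that $f(0)=f(1)$ is not smaller than the limit of $f$ at the endpoints). Consider sequences built by $x_0=0$ and, for $N\ge 1$, $$x_N\in\operatorname*{arg\,min}_{x\in(0,1)}\ \sum_{k=0}^{N-1}f(|x-x_k|),$$ where every global minimiser is admissible. Then a global minimiser exists at every step, whatever choices were made before, and for every sequence $X=(x_n)_{n\ge0}$ that can arise and every $N\ge 1$ there are $m\ge 1$ with $N\le 2^m$ and $\sigma\in\mathcal P_m$ such that $x_k=S_{2^m}^\sigma(k)$ for all $0\le k\le N$ and $$D_N(X)=D_N(\mathcal S_{2^m}^\sigma)=D_N(\mathcal S_2).$$ -/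

import Mathlib

open Set

noncomputable section

/-- Admissible kernels on `[0,1]`. The value `⊤` is allowed at the two endpoints, so that kernels
with a logarithmic singularity such as `1 - log (2 sin (π x))` are covered. Only the values of `f`
on `[0,1]` matter. The last field, convexity on the closed interval, constrains only the endpoint
value `f 0 = f 1`: on the open interval convexity follows from `f'' > 0`. -/
structure IsAdmissible (f : ℝ → EReal) : Prop where
  ne_bot : ∀ x ∈ Icc (0 : ℝ) 1, f x ≠ ⊥
  ne_top : ∀ x ∈ Ioo (0 : ℝ) 1, f x ≠ ⊤
  symm : ∀ x ∈ Icc (0 : ℝ) 1, f x = f (1 - x)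
  differentiable : DifferentiableOn ℝ (fun x => (f x).toReal) (Ioo 0 1)
  differentiable_deriv : DifferentiableOn ℝ (deriv fun x => (f x).toReal) (Ioo 0 1)
  deriv_deriv_pos : ∀ x ∈ Ioo (0 : ℝ) 1, 0 < deriv (deriv fun x => (f x).toReal) x
  convex : ∀ x ∈ Icc (0 : ℝ) 1, ∀ y ∈ Icc (0 : ℝ) 1, ∀ t ∈ Ioo (0 : ℝ) 1,
    f ((1 - t) * x + t * y) ≤ ((1 - t : ℝ) : EReal) * f x + (t : EReal) * f y

/-- The energy `∑_{k < N} f(|y - x_k|)`. -/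
def energy (f : ℝ → EReal) (x : ℕ → ℝ) (N : ℕ) (y : ℝ) : EReal :=
  ∑ k ∈ Finset.range N, f |y - x k|

/-- `y` is a global minimiser over `(0,1)` of the energy of the points `x_0, …, x_{N-1}`. -/
def IsGreedyChoice (f : ℝ → EReal) (x : ℕ → ℝ) (N : ℕ) (y : ℝ) : Prop :=
  y ∈ Ioo (0 : ℝ) 1 ∧ ∀ z ∈ Ioo (0 : ℝ) 1, energy f x N y ≤ energy f x N z

/-- `x_0, …, x_{N-1}` is a run of the greedy algorithm started from `x_0 = 0`. -/
def IsGreedyRun (f : ℝ → EReal) (x : ℕ → ℝ) (N : ℕ) : Prop :=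
  x 0 = 0 ∧ ∀ n, 0 < n → n < N → IsGreedyChoice f x n (x n)

/-- The infinite sequence `x` is a possible output of the greedy algorithm started from
`x_0 = 0`. -/
def IsGreedySequence (f : ℝ → EReal) (x : ℕ → ℝ) : Prop :=
  x 0 = 0 ∧ ∀ n, 0 < n → IsGreedyChoice f x n (x n)

/-- The `b`-adic radical inverse function `S_b`. -/
def radicalInverse (b n : ℕ) : ℝ :=
  ∑' j : ℕ, ((n / b ^ j % b : ℕ) : ℝ) / (b : ℝ) ^ (j + 1)

/-- The permuted `b`-adic radical inverse function `S_b^σ`. Here `Fin.ofNat b (n / b ^ j)` is the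
`j`-th `b`-adic digit `n / b ^ j % b` of `n`. -/
def permutedRadicalInverse (b : ℕ) [NeZero b] (σ : Equiv.Perm (Fin b)) (n : ℕ) : ℝ :=
  ∑' j : ℕ, ((σ (Fin.ofNat b (n / b ^ j)) : ℕ) : ℝ) / (b : ℝ) ^ (j + 1)

/-- The family `P_m` of permutations of `{0, …, 2^m - 1}`, `m ≥ 1`: `P_1 = {(0,1)}`, and `P_{m+1}`
consists of the concatenations `(2σ, 2σ' ⊕ a)` with `σ, σ' ∈ P_m` and odd `1 ≤ a ≤ 2^{m+1}`,
where `⊕` is addition modulo `2^{m+1}`. (The value at `m = 0` is irrelevant.) -/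
def permFamily : (m : ℕ) → Set (Equiv.Perm (Fin (2 ^ m)))
  | 0 => ∅
  | 1 => {1}
  | m + 2 => {ρ | ∃ σ ∈ permFamily (m + 1), ∃ σ' ∈ permFamily (m + 1), ∃ a : ℕ,
      Odd a ∧ 1 ≤ a ∧ a ≤ 2 ^ (m + 2) ∧
      ∀ i : Fin (2 ^ (m + 1)),
        (ρ (Fin.ofNat (2 ^ (m + 2)) i) : ℕ) = 2 * (σ i : ℕ) ∧
        (ρ (Fin.ofNat (2 ^ (m + 2)) (2 ^ (m + 1) + i)) : ℕ) =
          (2 * (σ' i : ℕ) + a) % 2 ^ (m + 2)}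

open Classical in
/-- The extreme discrepancy `D_N` of the first `N` points `x_0, …, x_{N-1}`. -/
def extremeDiscrepancy (x : ℕ → ℝ) (N : ℕ) : ℝ :=
  sSup {d : ℝ | ∃ α β : ℝ, 0 ≤ α ∧ α < β ∧ β < 1 ∧
    d = |(((Finset.range N).filter fun i => α ≤ x i ∧ x i < β).card : ℝ) / N - (β - α)|}

end

/-!
Read on the circle `ℝ / ℤ`, the algorithm doubles: a run consists of `2 ^ m` equispaced points
followed by a translate, by an odd multiple of `2 ^ (-(m + 1))`, of another run, and the same holds
for each of these two parts. `IsBinary` records this structure.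

*Greedy runs are binary* (`IsAdmissible.circleRun_structure`). By strict convexity and symmetry of
the kernel, the energy of `2 ^ m` equispaced points is minimal exactly at the midpoints between
neighbours (`IsAdmissible.isCircleMin_binary_iff`). After `2 ^ m + i` points the energy is the sum of
this one and the energy of the last `i` points. By induction the last `i` points form a run up to
translation, whose energy has a minimiser on the translated grid of mesh `2 ^ (-m)`. These grid
points are midpoints, so both summands have a common minimiser. Hence the minimisers of the sum are
exactly the common minimisers, and each new point continues the run formed by the last `i` points.

*Permutations* (`IsBinary.exists_perm`, `IsBinary.mem_permFamily`). Modulo `1` the first `2 ^ m`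
terms of a binary sequence are the points `j / 2 ^ m` in some order, and the recursion for the order
is the one defining `permFamily`.

*Discrepancy* (`IsBinary.sawtoothOsc_eq`). Counting points in an interval minus the expected number
is a difference of two values of the sawtooth sum `t ↦ ∑ k, fract (z k - t)`, so `N D_N` is the
oscillation of that function, which is invariant under translation. On each cell of the grid of mesh
`2 ^ (-m)`, adding `2 ^ m` equispaced points at the midpoints of the cells adds one and the same
function to the sawtooth sum, and this raises the oscillation by `1 - i / 2 ^ m`
(`IsBinary.sawtoothOsc_add`). The oscillation therefore depends only on `N`, and the van der Corput
sequence is binary (`isBinary_radicalInverse_two`).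
-/

/-! ### Binary sequences -/

/-- The first `2 ^ m` terms of `z` are built by doubling: they start at `0`, and for each `j < m` the
terms with index in `[2 ^ j, 2 ^ (j + 1))` are a translate, by an odd multiple of `2 ^ (-(j + 1))`,
of a sequence built in the same way. The terms are real numbers, to be read modulo `1`. -/
def IsBinary : ℕ → (ℕ → ℝ) → Prop
  | 0, z => z 0 = 0
  | m + 1, z => IsBinary m z ∧ (∃ a : ℤ, Odd a ∧ z (2 ^ m) = a / 2 ^ (m + 1)) ∧
      IsBinary m fun i => z (2 ^ m + i) - z (2 ^ m)

theorem IsBinary.congr {m : ℕ} {z w : ℕ → ℝ} (hz : IsBinary m z)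
    (h : ∀ k < 2 ^ m, z k = w k) : IsBinary m w := by
  induction m generalizing z w with
  | zero => exact (h 0 (by simp)).symm.trans hz
  | succ m ih =>
    obtain ⟨h1, ⟨a, ha, hza⟩, h2⟩ := hz
    have hp : 2 ^ (m + 1) = 2 ^ m + 2 ^ m := by ring
    have h0 : 0 < 2 ^ m := by positivity
    refine ⟨ih h1 fun k hk => h k (by omega), ⟨a, ha, ?_⟩, ih h2 fun k hk => ?_⟩
    · rw [← h _ (by omega), hza]
    · rw [h _ (by omega), h _ (by omega)]

theorem IsBinary.zero {m : ℕ} {z : ℕ → ℝ} (hz : IsBinary m z) : z 0 = 0 := by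
  induction m with
  | zero => exact hz
  | succ m ih => exact ih hz.1

theorem sum_range_periodic_shift {M : Type*} [AddCommMonoid M] (K : ℕ) (g : ℤ → M)
    (hg : ∀ n, g (n + K) = g n) (b : ℤ) :
    ∑ j ∈ Finset.range K, g (j + b) = ∑ j ∈ Finset.range K, g j := by
  have step (c : ℤ) : ∑ j ∈ Finset.range K, g (j + (c + 1)) = ∑ j ∈ Finset.range K, g (j + c) := by
    cases K with
    | zero => simp
    | succ K =>
      rw [Finset.sum_range_succ, Finset.sum_range_succ']
      congr 1
      · refine Finset.sum_congr rfl fun j _ => ?_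
        congr 1; push_cast; ring
      · rw [← hg (_ + c)]; congr 1; push_cast; ring
  induction b using Int.induction_on with
  | zero => simp
  | succ i ih => rw [step, ih]
  | pred i ih => rw [← ih, ← step]; congr! 3; ring

theorem sum_range_even_odd {M : Type*} [AddCommMonoid M] (K : ℕ) (g : ℕ → M) :
    ∑ j ∈ Finset.range (K + K), g j =
      ∑ j ∈ Finset.range K, g (2 * j) + ∑ j ∈ Finset.range K, g (2 * j + 1) := by
  induction K with
  | zero => simp
  | succ K ih =>
    rw [show K + 1 + (K + 1) = K + K + 1 + 1 by ring, Finset.sum_range_succ, Finset.sum_range_succ,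
      ih, Finset.sum_range_succ, Finset.sum_range_succ, show K + K = 2 * K by ring]
    abel

/-- Modulo `1`, the first `2 ^ m` terms of a binary sequence are the points `j / 2 ^ m`. -/
theorem IsBinary.sum_eq {M : Type*} [AddCommMonoid M] {m : ℕ} {z : ℕ → ℝ} (hz : IsBinary m z)
    (φ : ℝ → M) (hφ : Function.Periodic φ 1) :
    ∑ k ∈ Finset.range (2 ^ m), φ (z k) = ∑ j ∈ Finset.range (2 ^ m), φ (j / 2 ^ m) := by
  induction m generalizing z φ with
  | zero => simp [show z 0 = 0 from hz]
  | succ m ih =>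
    obtain ⟨h1, ⟨a, ⟨b, hb⟩, hza⟩, h2⟩ := hz
    have hp : 2 ^ (m + 1) = 2 ^ m + 2 ^ m := by ring
    have hK : (2 : ℝ) ^ m ≠ 0 := by positivity
    rw [hp, Finset.sum_range_add, ih h1 φ hφ, sum_range_even_odd]
    congr 1
    · refine Finset.sum_congr rfl fun j _ => ?_
      congr 1; push_cast; rw [pow_succ]; field_simp
    · have h3 := ih h2 (fun t => φ (t + z (2 ^ m))) fun t => by
        simp only [add_right_comm t 1, hφ (t + z (2 ^ m))]
      have h4 := sum_range_periodic_shift (2 ^ m) (fun n : ℤ => φ ((2 * n + 1) / 2 ^ (m + 1)))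
        (fun n => by
          rw [← hφ ((2 * n + 1) / 2 ^ (m + 1))]; congr 1; push_cast; rw [pow_succ]; field_simp; ring) b
      simp only [sub_add_cancel] at h3
      rw [h3]
      convert h4 using 3 with j _ j _
      · rw [hza, hb]; push_cast; rw [pow_succ]; field_simp; ring
      · push_cast; rfl

theorem IsBinary.mem_grid {m : ℕ} {z : ℕ → ℝ} (hz : IsBinary m z) {k : ℕ} (hk : k < 2 ^ m) :
    ∃ n : ℤ, z k = n / 2 ^ m := by
  induction m generalizing z k with
  | zero =>
    obtain rfl : k = 0 := by simpa using hk
    exact ⟨0, by simp [show z 0 = 0 from hz]⟩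
  | succ m ih =>
    obtain ⟨h1, ⟨a, ha, hza⟩, h2⟩ := hz
    have hp : 2 ^ (m + 1) = 2 ^ m + 2 ^ m := by ring
    rcases lt_or_ge k (2 ^ m) with h | h
    · obtain ⟨n, hn⟩ := ih h1 h
      refine ⟨2 * n, ?_⟩
      rw [hn, pow_succ]; push_cast; field_simp
    · obtain ⟨n, hn⟩ := ih h2 (k := k - 2 ^ m) (by omega)
      refine ⟨2 * n + a, ?_⟩
      rw [Nat.add_sub_cancel' h, sub_eq_iff_eq_add, hza] at hn
      rw [hn, pow_succ]; push_cast; field_simp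

theorem fract_int_div_pow (m : ℕ) (n : ℤ) :
    Int.fract ((n : ℝ) / 2 ^ m) = ((n % 2 ^ m : ℤ) : ℝ) / 2 ^ m := by
  have := Int.fract_div_intCast_eq_div_intCast_mod (k := ℝ) (m := n) (n := 2 ^ m)
  push_cast at this ⊢
  exact this

/-- The first `2 ^ m` terms of a binary sequence are given modulo `1` by a permutation. -/
theorem IsBinary.exists_perm {m : ℕ} {z : ℕ → ℝ} (hz : IsBinary m z) :
    ∃ σ : Equiv.Perm (Fin (2 ^ m)), ∀ k : Fin _, Int.fract (z k) = ((σ k : ℕ) : ℝ) / 2 ^ m := by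
  have hp : (0 : ℝ) < 2 ^ m := by positivity
  have hex (k : Fin (2 ^ m)) : ∃ v : Fin (2 ^ m), Int.fract (z k) = ((v : ℕ) : ℝ) / 2 ^ m := by
    obtain ⟨n, hn⟩ := hz.mem_grid k.2
    have hpos : (0 : ℤ) < 2 ^ m := by positivity
    have h0 := Int.emod_nonneg n hpos.ne'
    have h1 := Int.emod_lt_of_pos n hpos
    refine ⟨⟨(n % 2 ^ m).toNat, ?_⟩, ?_⟩
    · zify; rwa [Int.toNat_of_nonneg h0]
    · rw [hn, fract_int_div_pow]
      congr 1
      exact_mod_cast (Int.toNat_of_nonneg h0).symm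
  choose s hs using hex
  have hsurj : Function.Surjective s := by
    intro v
    classical
    by_contra hv
    push Not at hv
    have h := hz.sum_eq (fun t => if Int.fract t = ((v : ℕ) : ℝ) / 2 ^ m then 1 else 0)
      fun t => by simp only [Int.fract_add_one]
    rw [Finset.sum_eq_zero] at h
    · have h2 := (Finset.sum_eq_zero_iff.mp h.symm) v (Finset.mem_range.mpr v.2)
      have h3 := fract_int_div_pow m (v : ℕ)
      rw [Int.emod_eq_of_lt (by positivity) (by exact_mod_cast v.2)] at h3
      simp only [Int.cast_natCast] at h3
      simp [h3] at h2
    · intro k hk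
      rw [Finset.mem_range] at hk
      refine if_neg fun h3 => hv ⟨k, hk⟩ ?_
      have h4 := hs ⟨k, hk⟩
      rw [h3, div_left_inj' hp.ne'] at h4
      exact Fin.ext (by exact_mod_cast h4.symm)
  refine ⟨Equiv.ofBijective s (Finite.surjective_iff_bijective.mp hsurj), hs⟩

/-- The permutation describing a binary sequence belongs to the recursively defined family. -/
theorem IsBinary.mem_permFamily {m : ℕ} {z : ℕ → ℝ} (hz : IsBinary (m + 1) z)
    (ρ : Equiv.Perm (Fin (2 ^ (m + 1))))
    (hρ : ∀ k : Fin _, Int.fract (z k) = ((ρ k : ℕ) : ℝ) / 2 ^ (m + 1)) : ρ ∈ permFamily (m + 1) := by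
  induction m generalizing z with
  | zero =>
    have h0 := hρ 0
    rw [Fin.val_zero, hz.zero, Int.fract_zero, eq_comm, div_eq_zero_iff] at h0
    have h0' : ((ρ 0 : Fin 2) : ℕ) = 0 := by
      rcases h0 with h0 | h0
      · exact_mod_cast h0
      · norm_num at h0
    change ρ = 1
    have h1 : ρ 0 = 0 := Fin.ext h0'
    have h2 : ρ 1 ≠ 0 := fun h => by
      have := ρ.injective (h.trans h1.symm)
      exact absurd this (by decide)
    ext k
    change Fin 2 at k
    change ((ρ k : Fin 2) : ℕ) = (k : ℕ)
    fin_cases k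
    · exact h0'
    · have := (ρ 1).2
      have h3 : ((ρ 1 : Fin 2) : ℕ) ≠ 0 := fun h => h2 (Fin.ext h)
      change ((ρ 1 : Fin 2) : ℕ) = 1
      norm_num at this
      omega
  | succ m ih =>
    obtain ⟨h1, ⟨a, ha, hza⟩, h2⟩ := hz
    obtain ⟨σ, hσ⟩ := h1.exists_perm
    obtain ⟨σ', hσ'⟩ := h2.exists_perm
    have hK : (0 : ℝ) < 2 ^ (m + 1) := by positivity
    have hK2 : (0 : ℤ) < 2 ^ (m + 2) := by positivity
    have hp : 2 ^ (m + 2) = 2 ^ (m + 1) + 2 ^ (m + 1) := by ring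
    have ha0 := Int.emod_nonneg a hK2.ne'
    have ha1 := Int.emod_lt_of_pos a hK2
    obtain ⟨c, hc⟩ := Int.eq_ofNat_of_zero_le ha0
    have hodd : Odd c := by
      have hmod : a % 2 ^ (m + 2) % 2 = a % 2 := Int.emod_emod_of_dvd a (dvd_pow_self 2 (by omega))
      rw [Int.odd_iff] at ha
      rw [Nat.odd_iff]
      omega
    refine ⟨σ, ih h1 σ hσ, σ', ih h2 σ' hσ', c, hodd, hodd.pos, ?_, fun i => ⟨?_, ?_⟩⟩
    · rw [hc] at ha1; exact_mod_cast ha1.le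
    · have h3 := hρ (Fin.ofNat (2 ^ (m + 2)) i)
      rw [Fin.val_ofNat, Nat.mod_eq_of_lt (by omega), hσ i] at h3
      generalize (ρ (Fin.ofNat (2 ^ (m + 2)) i) : ℕ) = r at h3 ⊢
      rw [pow_succ _ (m + 1)] at h3
      field_simp at h3
      have h4 : 2 * (σ i : ℕ) = r := by
        rw [mul_comm]; exact_mod_cast h3
      exact h4.symm
    · have h3 := hρ (Fin.ofNat (2 ^ (m + 2)) (2 ^ (m + 1) + i))
      rw [Fin.val_ofNat, Nat.mod_eq_of_lt (by omega)] at h3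
      have h4 : z (2 ^ (m + 1) + i) =
          ((2 * (σ' i : ℕ) + a : ℤ) : ℝ) / 2 ^ (m + 2) + ⌊z (2 ^ (m + 1) + i) - z (2 ^ (m + 1))⌋ := by
        have h5 := hσ' i
        rw [Int.fract, hza] at h5
        rw [hza]
        rw [sub_eq_iff_eq_add, sub_eq_iff_eq_add] at h5
        generalize ⌊z (2 ^ (m + 1) + i) - a / 2 ^ (m + 1 + 1)⌋ = w at h5 ⊢
        rw [h5, pow_succ _ (m + 1)]; push_cast; field_simp; ring
      rw [h4, Int.fract_add_intCast, fract_int_div_pow, div_left_inj' (by positivity)] at h3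
      have h5 : (2 * (σ' i : ℕ) + a : ℤ) % 2 ^ (m + 2) = (2 * (σ' i : ℕ) + c : ℤ) % 2 ^ (m + 2) := by
        have hc' : a % 2 ^ (m + 2) = c := hc
        rw [← hc', Int.add_emod_emod]
      rw [h5] at h3
      exact_mod_cast h3.symm

/-! ### Radical inverses -/

/-- On indices with a single base-`b` digit, the permuted radical inverse only reads `σ`. -/
theorem permutedRadicalInverse_of_lt (b : ℕ) [NeZero b] (σ : Equiv.Perm (Fin b)) (h0 : σ 0 = 0)
    (k : Fin b) : permutedRadicalInverse b σ k = ((σ k : ℕ) : ℝ) / b := by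
  rw [permutedRadicalInverse, tsum_eq_single 0]
  · simp
  · intro j hj
    have hk : (k : ℕ) < b ^ j := k.2.trans_le (Nat.le_self_pow hj b)
    rw [Nat.div_eq_of_lt hk, show Fin.ofNat b 0 = 0 from Fin.ofNat_zero b, h0]
    simp

theorem radicalInverse_two_eq (n : ℕ) :
    radicalInverse 2 n = ((n % 2 : ℕ) : ℝ) / 2 + radicalInverse 2 (n / 2) / 2 := by
  have hs : Summable fun j : ℕ => ((n / 2 ^ j % 2 : ℕ) : ℝ) / ((2 : ℕ) : ℝ) ^ (j + 1) := by
    refine Summable.of_nonneg_of_le (fun j => by positivity) (fun j => ?_)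
      (summable_geometric_of_lt_one (r := (1 / 2 : ℝ)) (by norm_num) (by norm_num))
    have : ((n / 2 ^ j % 2 : ℕ) : ℝ) ≤ 1 := by
      exact_mod_cast Nat.le_of_lt_succ (Nat.mod_lt _ two_pos)
    rw [div_pow, one_pow, Nat.cast_two]
    refine div_le_div₀ zero_le_one this (by positivity) ?_
    exact pow_le_pow_right₀ one_le_two (Nat.le_succ j)
  rw [radicalInverse, hs.tsum_eq_zero_add, radicalInverse, ← tsum_div_const]
  congr 1
  · simp
  · refine tsum_congr fun j => ?_
    rw [Nat.div_div_eq_div_mul, ← pow_succ', pow_succ _ (j + 1), div_div,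
      Nat.cast_two]

theorem radicalInverse_two_zero : radicalInverse 2 0 = 0 := by simp [radicalInverse]

theorem radicalInverse_two_mem (n : ℕ) : radicalInverse 2 n ∈ Ico (0 : ℝ) 1 := by
  induction n using Nat.strong_induction_on with
  | _ n ih =>
    rcases Nat.eq_zero_or_pos n with rfl | hn
    · simp [radicalInverse_two_zero]
    · have h := ih (n / 2) (by omega)
      rw [radicalInverse_two_eq]
      have : ((n % 2 : ℕ) : ℝ) ≤ 1 := by
        exact_mod_cast Nat.le_of_lt_succ (Nat.mod_lt _ two_pos)
      have : (0 : ℝ) ≤ ((n % 2 : ℕ) : ℝ) := by positivity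
      constructor <;> linarith [h.1, h.2]

theorem radicalInverse_two_pow_add (m i : ℕ) (hi : i < 2 ^ m) :
    radicalInverse 2 (2 ^ m + i) = radicalInverse 2 i + 1 / 2 ^ (m + 1) := by
  induction m generalizing i with
  | zero =>
    obtain rfl : i = 0 := by simpa using hi
    rw [radicalInverse_two_eq]
    simp [radicalInverse_two_zero]
  | succ m ih =>
    have hp : 2 ^ (m + 1) = 2 * 2 ^ m := by ring
    rw [radicalInverse_two_eq, radicalInverse_two_eq i, show (2 ^ (m + 1) + i) % 2 = i % 2 by omega,
      show (2 ^ (m + 1) + i) / 2 = 2 ^ m + i / 2 by omega, ih _ (by omega), pow_succ _ (m + 1)]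
    field_simp
    ring

theorem isBinary_radicalInverse_two (m : ℕ) : IsBinary m (radicalInverse 2) := by
  have h (m : ℕ) : radicalInverse 2 (2 ^ m) = 1 / 2 ^ (m + 1) := by
    simpa [radicalInverse_two_zero] using radicalInverse_two_pow_add m 0 (by positivity)
  induction m with
  | zero => exact radicalInverse_two_zero
  | succ m ih =>
    refine ⟨ih, ⟨1, odd_one, by rw [h]; simp⟩, ih.congr fun k hk => ?_⟩
    rw [radicalInverse_two_pow_add m k hk, h, add_sub_cancel_right]

/-! ### Discrepancy as the oscillation of a sum of sawtooth functions -/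

/-- The sum of sawtooth functions with jumps at the points `z 0, …, z (N - 1)` modulo `1`. Up to an
additive constant, its value at `t ∈ [0, 1]` counts the points in `[0, t)` and subtracts `N t`. -/
noncomputable def sawtoothSum (z : ℕ → ℝ) (N : ℕ) (t : ℝ) : ℝ :=
  ∑ k ∈ Finset.range N, Int.fract (z k - t)

/-- The oscillation of `sawtoothSum z N`. It does not change under translations of `z`. -/
noncomputable def sawtoothOsc (z : ℕ → ℝ) (N : ℕ) : ℝ :=
  sSup (range (sawtoothSum z N)) - sInf (range (sawtoothSum z N))

theorem sawtoothSum_nonneg (z : ℕ → ℝ) (N : ℕ) (t : ℝ) : 0 ≤ sawtoothSum z N t :=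
  Finset.sum_nonneg fun _ _ => Int.fract_nonneg _

theorem sawtoothSum_le (z : ℕ → ℝ) (N : ℕ) (t : ℝ) : sawtoothSum z N t ≤ N := by
  have := Finset.sum_le_sum (s := Finset.range N) fun k _ => (Int.fract_lt_one (z k - t)).le
  simpa [sawtoothSum] using this

theorem bddAbove_range_sawtoothSum (z : ℕ → ℝ) (N : ℕ) : BddAbove (range (sawtoothSum z N)) :=
  ⟨N, forall_mem_range.2 (sawtoothSum_le z N)⟩

theorem bddBelow_range_sawtoothSum (z : ℕ → ℝ) (N : ℕ) : BddBelow (range (sawtoothSum z N)) :=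
  ⟨0, forall_mem_range.2 (sawtoothSum_nonneg z N)⟩

theorem sawtoothSum_fract (z : ℕ → ℝ) (N : ℕ) (t : ℝ) :
    sawtoothSum z N (Int.fract t) = sawtoothSum z N t := by
  refine Finset.sum_congr rfl fun k _ => ?_
  rw [← Int.self_sub_floor t, sub_sub_eq_add_sub, add_sub_right_comm, Int.fract_add_intCast]

theorem fract_sub_of_mem {p t : ℝ} (hp : p ∈ Ico (0 : ℝ) 1) (ht : t ∈ Ico (0 : ℝ) 1) :
    Int.fract (p - t) = p - t + if p < t then 1 else 0 := by
  obtain ⟨hp0, hp1⟩ := hp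
  obtain ⟨ht0, ht1⟩ := ht
  split_ifs with h
  · exact Int.fract_eq_iff.2 ⟨by linarith, by linarith, -1, by push_cast; ring⟩
  · exact Int.fract_eq_iff.2 ⟨by linarith, by linarith, 0, by push_cast; ring⟩

open Classical in
theorem card_sub_eq_sawtoothSum_sub {x : ℕ → ℝ} {N : ℕ} (hx : ∀ k < N, x k ∈ Ico (0 : ℝ) 1)
    {α β : ℝ} (h0 : 0 ≤ α) (h : α ≤ β) (h1 : β < 1) :
    (((Finset.range N).filter fun i => α ≤ x i ∧ x i < β).card : ℝ) - N * (β - α) =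
      sawtoothSum x N β - sawtoothSum x N α := by
  rw [Finset.card_filter, sawtoothSum, sawtoothSum, ← Finset.sum_sub_distrib]
  have : (N : ℝ) * (β - α) = ∑ k ∈ Finset.range N, (β - α) := by
    rw [Finset.sum_const, Finset.card_range, nsmul_eq_mul]
  rw [this]
  push_cast
  rw [← Finset.sum_sub_distrib]
  refine Finset.sum_congr rfl fun k hk => ?_
  have hk' := hx k (Finset.mem_range.1 hk)
  rw [fract_sub_of_mem hk' ⟨h0.trans h, h1⟩, fract_sub_of_mem hk' ⟨h0, h.trans_lt h1⟩]
  split_ifs <;> grind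

/-- By periodicity it does not matter that the intervals in `extremeDiscrepancy` may not wrap around
the circle and may not end at `1`. -/
theorem extremeDiscrepancy_eq_osc {x : ℕ → ℝ} {N : ℕ} (hN : 0 < N)
    (hx : ∀ k < N, x k ∈ Ico (0 : ℝ) 1) : extremeDiscrepancy x N = sawtoothOsc x N / N := by
  classical
  have hN' : (0 : ℝ) < N := by exact_mod_cast hN
  have key {α β : ℝ} (h0 : 0 ≤ α) (h : α < β) (h1 : β < 1) :
      |(((Finset.range N).filter fun i => α ≤ x i ∧ x i < β).card : ℝ) / N - (β - α)| =
        |sawtoothSum x N β - sawtoothSum x N α| / N := by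
    rw [← card_sub_eq_sawtoothSum_sub hx h0 h.le h1, ← abs_of_pos hN', ← abs_div, abs_of_pos hN']
    congr 1
    field_simp
  have hset : {d : ℝ | ∃ α β : ℝ, 0 ≤ α ∧ α < β ∧ β < 1 ∧
      d = |(((Finset.range N).filter fun i => α ≤ x i ∧ x i < β).card : ℝ) / N - (β - α)|} =
      {d : ℝ | ∃ α β : ℝ, 0 ≤ α ∧ α < β ∧ β < 1 ∧
        d = |sawtoothSum x N β - sawtoothSum x N α| / N} := by
    ext d
    constructor <;> rintro ⟨α, β, h0, h, h1, rfl⟩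
    · exact ⟨α, β, h0, h, h1, key h0 h h1⟩
    · exact ⟨α, β, h0, h, h1, (key h0 h h1).symm⟩
  have hle (u v : ℝ) : sawtoothSum x N u - sawtoothSum x N v ≤ sawtoothOsc x N :=
    sub_le_sub (le_csSup (bddAbove_range_sawtoothSum x N) ⟨u, rfl⟩)
      (csInf_le (bddBelow_range_sawtoothSum x N) ⟨v, rfl⟩)
  have hub : sawtoothOsc x N / N ∈ upperBounds {d : ℝ | ∃ α β : ℝ, 0 ≤ α ∧ α < β ∧ β < 1 ∧
      d = |sawtoothSum x N β - sawtoothSum x N α| / N} := by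
    rintro d ⟨α, β, -, -, -, rfl⟩
    gcongr
    exact abs_sub_le_iff.2 ⟨hle _ _, hle _ _⟩
  rw [extremeDiscrepancy]
  convert_to sSup {d : ℝ | ∃ α β : ℝ, 0 ≤ α ∧ α < β ∧ β < 1 ∧
      d = |sawtoothSum x N β - sawtoothSum x N α| / N} = _
  · rw [← hset]
  refine IsLUB.csSup_eq ⟨hub, fun B hB => ?_⟩ ⟨_, 0, 1 / 2, le_rfl, by norm_num, by norm_num, rfl⟩
  -- Any two values of the sawtooth sum differ by at most `B * N`: reduce both arguments modulo `1`.
  have hdiff (u v : ℝ) : sawtoothSum x N u - sawtoothSum x N v ≤ B * N := by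
    have hB' {α β : ℝ} (h0 : 0 ≤ α) (h : α < β) (h1 : β < 1) :
        |sawtoothSum x N β - sawtoothSum x N α| ≤ B * N :=
      (div_le_iff₀ hN').1 (hB ⟨α, β, h0, h, h1, rfl⟩)
    rw [← sawtoothSum_fract x N u, ← sawtoothSum_fract x N v]
    rcases lt_trichotomy (Int.fract u) (Int.fract v) with h | h | h
    · exact (neg_sub (sawtoothSum x N (Int.fract v)) _ ▸ neg_le_abs _).trans
        (hB' (Int.fract_nonneg u) h (Int.fract_lt_one v))
    · rw [h, sub_self]
      exact (abs_nonneg _).trans (hB' (α := 0) (β := 1 / 2) le_rfl (by norm_num) (by norm_num))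
    · exact (le_abs_self _).trans (hB' (Int.fract_nonneg v) h (Int.fract_lt_one u))
  rw [div_le_iff₀ hN', sawtoothOsc, sub_le_iff_le_add]
  refine csSup_le (range_nonempty _) (forall_mem_range.2 fun u => ?_)
  rw [← sub_le_iff_le_add']
  refine le_csInf (range_nonempty _) (forall_mem_range.2 fun v => ?_)
  linarith [hdiff u v]

/-! ### The discrepancy of binary sequences -/

/-- If `G` is a constant plus a fixed profile `h` on each cell of a grid, then its oscillation is
that of the constants plus that of the profile. -/
theorem osc_eq_of_cells {K : ℝ} (hK : 0 < K) {G h : ℝ → ℝ} {c : ℤ → ℝ} {H L : ℝ}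
    (hG : ∀ (j : ℤ), ∀ θ ∈ Ioc (0 : ℝ) 1, G ((j + θ) / K) = c j + h θ)
    (hca : BddAbove (range c)) (hcb : BddBelow (range c))
    (hH : IsLUB (h '' Ioc 0 1) H) (hL : IsGLB (h '' Ioc 0 1) L) :
    sSup (range G) - sInf (range G) = sSup (range c) - sInf (range c) + (H - L) := by
  have hne : (h '' Ioc (0 : ℝ) 1).Nonempty := ⟨_, 1, by simp, rfl⟩
  have hr : range G = image2 (· + ·) (range c) (h '' Ioc 0 1) := by
    ext d
    constructor
    · rintro ⟨u, rfl⟩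
      refine ⟨_, ⟨⌈K * u⌉ - 1, rfl⟩, _, ⟨K * u - (⌈K * u⌉ - 1), ⟨?_, ?_⟩, rfl⟩, ?_⟩
      · linarith [Int.ceil_lt_add_one (K * u)]
      · linarith [Int.le_ceil (K * u)]
      · dsimp only
        rw [← hG _ _ ⟨by linarith [Int.ceil_lt_add_one (K * u)], by linarith [Int.le_ceil (K * u)]⟩]
        congr 1
        push_cast
        field_simp
        ring
    · rintro ⟨_, ⟨j, rfl⟩, _, ⟨θ, hθ, rfl⟩, rfl⟩
      exact ⟨_, hG j θ hθ⟩
  have h1 : sSup (range G) = sSup (range c) + sSup (h '' Ioc 0 1) := by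
    rw [hr]
    exact csSup_add (range_nonempty c) hca hne hH.bddAbove
  have h2 : sInf (range G) = sInf (range c) + sInf (h '' Ioc 0 1) := by
    rw [hr]
    exact csInf_add (range_nonempty c) hcb hne hL.bddBelow
  rw [h1, h2, hH.csSup_eq hne, hL.csInf_eq hne]
  ring

/-- Between consecutive grid points, the sawtooth sum of points on the grid is affine. -/
theorem sawtoothSum_cell {m N : ℕ} {z : ℕ → ℝ} (hz : ∀ k < N, ∃ n : ℤ, z k = n / 2 ^ m) (j : ℤ)
    {θ : ℝ} (hθ : θ ∈ Ioc (0 : ℝ) 1) :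
    sawtoothSum z N ((j + θ) / 2 ^ m) =
      sawtoothSum z N ((j + 1) / 2 ^ m) + N / 2 ^ m * (1 - θ) := by
  have hN : (N : ℝ) / 2 ^ m * (1 - θ) = ∑ k ∈ Finset.range N, (1 - θ) / 2 ^ m := by
    simp; ring
  rw [hN, sawtoothSum, sawtoothSum, ← Finset.sum_add_distrib]
  refine Finset.sum_congr rfl fun k hk => ?_
  obtain ⟨n, hn⟩ := hz k (Finset.mem_range.1 hk)
  have hK : (0 : ℝ) < 2 ^ m := by positivity
  have hpos : (0 : ℤ) < 2 ^ m := by positivity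
  have e : (n : ℝ) / 2 ^ m - (j + 1) / 2 ^ m = ((n - j - 1 : ℤ) : ℝ) / 2 ^ m := by
    push_cast; ring
  have h0 : (0 : ℝ) ≤ ((n - j - 1) % 2 ^ m : ℤ) := by
    exact_mod_cast Int.emod_nonneg _ hpos.ne'
  have h1 : (((n - j - 1) % 2 ^ m : ℤ) : ℝ) + 1 ≤ 2 ^ m := by
    exact_mod_cast Int.emod_lt_of_pos (n - j - 1) hpos
  rw [hn, e]
  refine Int.fract_eq_iff.2 ⟨?_, ?_, ⌊((n - j - 1 : ℤ) : ℝ) / 2 ^ m⌋, ?_⟩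
  · have := Int.fract_nonneg (((n - j - 1 : ℤ) : ℝ) / 2 ^ m)
    have : 0 ≤ (1 - θ) / 2 ^ m := div_nonneg (by linarith [hθ.2]) hK.le
    linarith
  · rw [fract_int_div_pow, ← add_div, div_lt_one hK]
    linarith [hθ.1]
  · rw [Int.fract]; push_cast; ring

theorem sum_fract_div (K : ℕ) (hK : 0 < K) (s : ℝ) :
    ∑ l ∈ Finset.range K, Int.fract ((l + s) / K) = (K - 1) / 2 + Int.fract s := by
  have hK' : (0 : ℝ) < K := by exact_mod_cast hK
  have h := sum_range_periodic_shift K (fun n : ℤ => Int.fract ((n + Int.fract s) / K))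
    (fun n => by
      rw [← Int.fract_add_one ((n + Int.fract s) / K)]; congr 1; push_cast; field_simp; ring) ⌊s⌋
  have h1 (l : ℕ) : ((l + s) / K : ℝ) = ((((l : ℤ) + ⌊s⌋ : ℤ) : ℝ) + Int.fract s) / K := by
    rw [Int.fract]; push_cast; ring
  simp only [h1]
  rw [h]
  have h2 : ∀ l ∈ Finset.range K, Int.fract ((((l : ℤ) : ℝ) + Int.fract s) / K) =
      (l + Int.fract s) / K := by
    intro l hl
    have : (l : ℝ) + 1 ≤ K := by exact_mod_cast Finset.mem_range.1 hl
    rw [Int.cast_natCast, Int.fract_eq_self]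
    refine ⟨div_nonneg (add_nonneg l.cast_nonneg (Int.fract_nonneg s)) hK'.le, ?_⟩
    rw [div_lt_one hK']
    linarith [Int.fract_lt_one s]
  rw [Finset.sum_congr rfl h2, ← Finset.sum_div, Finset.sum_add_distrib]
  have h3 : (∑ l ∈ Finset.range K, (l : ℝ)) = K * (K - 1) / 2 := by
    have := Finset.sum_range_id_mul_two K
    have h4 : (∑ l ∈ Finset.range K, (l : ℝ)) * 2 = K * ((K - 1 : ℕ) : ℝ) := by
      rw [← Nat.cast_sum, ← Nat.cast_ofNat, ← Nat.cast_mul, this, Nat.cast_mul]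
    rw [Nat.cast_pred hK] at h4
    linarith
  rw [h3, Finset.sum_const, Finset.card_range, nsmul_eq_mul]
  field_simp

theorem fract_half_sub {θ : ℝ} (hθ : θ ∈ Ioc (0 : ℝ) 1) :
    Int.fract (1 / 2 - θ) = 1 / 2 - θ + if θ ≤ 1 / 2 then 0 else 1 := by
  obtain ⟨h0, h1⟩ := hθ
  split_ifs with h
  · exact Int.fract_eq_iff.2 ⟨by linarith, by linarith, 0, by push_cast; ring⟩
  · exact Int.fract_eq_iff.2 ⟨by linarith, by linarith, -1, by push_cast; ring⟩

theorem isLUB_linear_profile {r : ℝ} (h0 : 0 ≤ r) (h1 : r ≤ 1) :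
    IsLUB ((fun θ => r * (1 - θ)) '' Ioc 0 1) r := by
  constructor
  · rintro _ ⟨θ, ⟨hθ0, hθ1⟩, rfl⟩
    dsimp only
    nlinarith
  · intro B hB
    refine le_of_forall_pos_le_add fun ε hε => ?_
    have h := hB ⟨min ε 1, ⟨lt_min hε one_pos, min_le_right _ _⟩, rfl⟩
    dsimp only at h
    have : 0 < min ε 1 := lt_min hε one_pos
    nlinarith [min_le_left ε 1]

theorem isGLB_linear_profile {r : ℝ} (h0 : 0 ≤ r) :
    IsGLB ((fun θ => r * (1 - θ)) '' Ioc 0 1) 0 := by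
  refine IsLeast.isGLB ⟨⟨1, by simp, by simp⟩, ?_⟩
  rintro _ ⟨θ, ⟨hθ0, hθ1⟩, rfl⟩
  exact mul_nonneg h0 (by linarith)

theorem isLUB_jump_profile {r : ℝ} (h0 : 0 ≤ r) (h1 : r ≤ 1) (d : ℝ) :
    IsLUB ((fun θ => d + Int.fract (1 / 2 - θ) + r * (1 - θ)) '' Ioc 0 1) (d + 1 + r / 2) := by
  constructor
  · rintro _ ⟨θ, hθ, rfl⟩
    dsimp only
    rw [fract_half_sub hθ]
    obtain ⟨hθ0, hθ1⟩ := hθ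
    split_ifs with h <;> nlinarith
  · intro B hB
    refine le_of_forall_pos_le_add fun ε hε => ?_
    -- The supremum is the limit from the right at the jump `1 / 2`.
    have hδ : 0 < min (ε / 2) (1 / 2) := lt_min (by linarith) (by norm_num)
    have hδ' := min_le_right (ε / 2) (1 / 2)
    have hθ : 1 / 2 + min (ε / 2) (1 / 2) ∈ Ioc (0 : ℝ) 1 := ⟨by linarith, by linarith⟩
    have h := hB ⟨_, hθ, rfl⟩
    dsimp only at h
    rw [fract_half_sub hθ, if_neg (by linarith)] at h
    nlinarith [min_le_left (ε / 2) (1 / 2)]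

theorem isGLB_jump_profile {r : ℝ} (h0 : 0 ≤ r) (h1 : r ≤ 1) (d : ℝ) :
    IsGLB ((fun θ => d + Int.fract (1 / 2 - θ) + r * (1 - θ)) '' Ioc 0 1) (d + r / 2) := by
  refine IsLeast.isGLB ⟨⟨1 / 2, by norm_num, ?_⟩, ?_⟩
  · simp; ring
  · rintro _ ⟨θ, hθ, rfl⟩
    dsimp only
    rw [fract_half_sub hθ]
    obtain ⟨hθ0, hθ1⟩ := hθ
    split_ifs with h <;> nlinarith

/-- Adding the equispaced points `j / 2 ^ m` to `i ≤ 2 ^ m` points lying at the midpoints between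
them changes the oscillation by an amount that depends only on `i` and `m`. -/
theorem IsBinary.sawtoothOsc_add {m i : ℕ} {z : ℕ → ℝ} (hz : IsBinary (m + 1) z)
    (hi : i ≤ 2 ^ m) :
    sawtoothOsc z (2 ^ m + i) =
      sawtoothOsc (fun k => z (2 ^ m + k) - z (2 ^ m)) i + (1 - i / 2 ^ m) := by
  obtain ⟨h1, ⟨a, ⟨b, hb⟩, hza⟩, h2⟩ := hz
  set w : ℕ → ℝ := fun k => z (2 ^ m + k) - z (2 ^ m) with hw
  have hK : (0 : ℝ) < 2 ^ m := by positivity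
  have hr0 : (0 : ℝ) ≤ i / 2 ^ m := by positivity
  have hr1 : (i : ℝ) / 2 ^ m ≤ 1 := by rw [div_le_one hK]; exact_mod_cast hi
  have hgrid : ∀ k < i, ∃ n : ℤ, w k = n / 2 ^ m := fun k hk => h2.mem_grid (by omega)
  set c : ℤ → ℝ := fun j => sawtoothSum w i ((j + 1) / 2 ^ m) with hc
  have hca : BddAbove (range c) :=
    (bddAbove_range_sawtoothSum w i).mono (by rintro _ ⟨j, rfl⟩; exact ⟨_, rfl⟩)
  have hcb : BddBelow (range c) :=
    (bddBelow_range_sawtoothSum w i).mono (by rintro _ ⟨j, rfl⟩; exact ⟨_, rfl⟩)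
  have e1 := osc_eq_of_cells hK (G := sawtoothSum w i) (c := c)
    (fun j θ hθ => sawtoothSum_cell hgrid j hθ) hca hcb
    (isLUB_linear_profile hr0 hr1) (isGLB_linear_profile hr0)
  have hG (j : ℤ) (θ : ℝ) (hθ : θ ∈ Ioc (0 : ℝ) 1) :
      sawtoothSum z (2 ^ m + i) ((j + θ) / 2 ^ m + z (2 ^ m)) =
        c j + ((2 ^ m - 1) / 2 + Int.fract (1 / 2 - θ) + i / 2 ^ m * (1 - θ)) := by
    have hA : ∑ k ∈ Finset.range (2 ^ m), Int.fract (z k - ((j + θ) / 2 ^ m + z (2 ^ m))) =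
        (2 ^ m - 1) / 2 + Int.fract (1 / 2 - θ) := by
      rw [h1.sum_eq (fun t => Int.fract (t - ((j + θ) / 2 ^ m + z (2 ^ m)))) fun t => by
        simp only [add_sub_right_comm t 1, Int.fract_add_one]]
      have h := sum_fract_div (2 ^ m) (by positivity) (1 / 2 - θ + ((-j - b - 1 : ℤ) : ℝ))
      rw [Int.fract_add_intCast] at h
      push_cast at h
      rw [← h]
      refine Finset.sum_congr rfl fun l _ => ?_
      congr 1
      rw [hza, hb, pow_succ]
      push_cast
      field_simp
      ring
    have hB : ∑ k ∈ Finset.range i,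
        Int.fract (z (2 ^ m + k) - ((j + θ) / 2 ^ m + z (2 ^ m))) =
          c j + i / 2 ^ m * (1 - θ) := by
      rw [← sawtoothSum_cell hgrid j hθ]
      refine Finset.sum_congr rfl fun k _ => ?_
      rw [hw]
      congr 1
      ring
    rw [sawtoothSum, Finset.sum_range_add, hA, hB]
    ring
  have e2 := osc_eq_of_cells hK (G := fun u => sawtoothSum z (2 ^ m + i) (u + z (2 ^ m)))
    (c := c) hG hca hcb (isLUB_jump_profile hr0 hr1 _) (isGLB_jump_profile hr0 hr1 _)
  have e3 : range (fun u => sawtoothSum z (2 ^ m + i) (u + z (2 ^ m))) =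
      range (sawtoothSum z (2 ^ m + i)) :=
    (Equiv.addRight (z (2 ^ m))).surjective.range_comp (sawtoothSum z (2 ^ m + i))
  rw [e3] at e2
  rw [sawtoothOsc, sawtoothOsc, e1, e2]
  ring

/-- The oscillation of a binary sequence depends only on the number of points. -/
theorem IsBinary.sawtoothOsc_eq {m N : ℕ} {z w : ℕ → ℝ} (hz : IsBinary m z) (hw : IsBinary m w)
    (hN : N ≤ 2 ^ m) : sawtoothOsc z N = sawtoothOsc w N := by
  induction m generalizing N z w with
  | zero =>
    have h : sawtoothSum z N = sawtoothSum w N := by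
      ext t
      refine Finset.sum_congr rfl fun k hk => ?_
      rw [Finset.mem_range] at hk
      obtain rfl : k = 0 := by rw [pow_zero] at hN; omega
      rw [hz.zero, hw.zero]
    rw [sawtoothOsc, sawtoothOsc, h]
  | succ m ih =>
    have hp : 2 ^ (m + 1) = 2 ^ m + 2 ^ m := by ring
    rcases le_total N (2 ^ m) with h | h
    · exact ih hz.1 hw.1 h
    · obtain ⟨i, rfl⟩ := Nat.exists_eq_add_of_le h
      rw [hz.sawtoothOsc_add (by omega), hw.sawtoothOsc_add (by omega),
        ih hz.2.2 hw.2.2 (by omega)]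

/-! ### Energies on the circle -/

theorem eq_and_eq_of_add_le_add {a b a₀ b₀ : EReal} (ha : a₀ ≤ a) (hb : b₀ ≤ b)
    (h : a + b ≤ a₀ + b₀) (ha₀ : a₀ ≠ ⊥) (hb₀ : b₀ ≠ ⊥) (hat : a₀ ≠ ⊤) (hbt : b₀ ≠ ⊤) :
    a = a₀ ∧ b = b₀ := by
  lift a₀ to ℝ using ⟨hat, ha₀⟩
  lift b₀ to ℝ using ⟨hbt, hb₀⟩
  have hab : a ≠ ⊥ := fun h' => by simp [h'] at ha
  have hbb : b ≠ ⊥ := fun h' => by simp [h'] at hb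
  have hlt : a + b < ⊤ := h.trans_lt (EReal.add_lt_top (EReal.coe_ne_top _) (EReal.coe_ne_top _))
  have hat' : a ≠ ⊤ := fun h' => by simp [h', EReal.top_add_of_ne_bot hbb] at hlt
  have hbt' : b ≠ ⊤ := fun h' => by simp [h', EReal.add_top_of_ne_bot hab] at hlt
  lift a to ℝ using ⟨hat', hab⟩
  lift b to ℝ using ⟨hbt', hbb⟩
  norm_cast at *
  constructor <;> linarith

theorem sum_ne_bot_of_forall {ι : Type*} (s : Finset ι) (g : ι → EReal) (h : ∀ i ∈ s, g i ≠ ⊥) :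
    ∑ i ∈ s, g i ≠ ⊥ := by
  classical
  induction s using Finset.induction_on with
  | empty => simp
  | insert i s hi ih =>
    rw [Finset.sum_insert hi, EReal.add_ne_bot_iff]
    exact ⟨h i (Finset.mem_insert_self i s), ih fun j hj => h j (Finset.mem_insert_of_mem hj)⟩

theorem sum_range_succ_lt_sum {g h : ℕ → EReal} (n : ℕ) (hlt : ∀ i ≤ n, g i < h i) :
    ∑ i ∈ Finset.range (n + 1), g i < ∑ i ∈ Finset.range (n + 1), h i := by
  induction n with
  | zero => simpa using hlt 0 le_rfl
  | succ n ih =>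
    rw [Finset.sum_range_succ, Finset.sum_range_succ _ (n + 1)]
    exact EReal.add_lt_add (ih fun i hi => hlt i (by omega)) (hlt _ le_rfl)

/-- The extension of a kernel on `[0, 1]` to a function of period `1`. -/
noncomputable def circleKernel (f : ℝ → EReal) (t : ℝ) : EReal := f (Int.fract t)

/-- The energy of `z 0, …, z (n - 1)`, viewed as points on the circle `ℝ / ℤ`. -/
noncomputable def circleEnergy (f : ℝ → EReal) (z : ℕ → ℝ) (n : ℕ) (y : ℝ) : EReal :=
  ∑ k ∈ Finset.range n, circleKernel f (y - z k)

/-- `y` is a global minimiser of the energy over the whole circle. -/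
def IsCircleMin (f : ℝ → EReal) (z : ℕ → ℝ) (n : ℕ) (y : ℝ) : Prop :=
  ∀ u, circleEnergy f z n y ≤ circleEnergy f z n u

/-- The analogue of `IsGreedyRun` on the circle, with no point excluded from the minimisation. -/
def IsCircleRun (f : ℝ → EReal) (z : ℕ → ℝ) (n : ℕ) : Prop :=
  z 0 = 0 ∧ ∀ k, 0 < k → k < n → IsCircleMin f z k (z k)

theorem IsCircleRun.mono {f : ℝ → EReal} {z : ℕ → ℝ} {k n : ℕ} (h : IsCircleRun f z n)
    (hk : k ≤ n) : IsCircleRun f z k :=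
  ⟨h.1, fun j h0 hj => h.2 j h0 (hj.trans_le hk)⟩

theorem circleKernel_periodic (f : ℝ → EReal) : Function.Periodic (circleKernel f) 1 := fun t => by
  rw [circleKernel, Int.fract_add_one, circleKernel]

theorem circleEnergy_fract (f : ℝ → EReal) (z : ℕ → ℝ) (n : ℕ) (y : ℝ) :
    circleEnergy f z n (Int.fract y) = circleEnergy f z n y := by
  refine Finset.sum_congr rfl fun k _ => ?_
  rw [circleKernel, circleKernel, ← Int.self_sub_floor y, sub_right_comm, Int.fract_sub_intCast]

namespace IsAdmissible

variable {f : ℝ → EReal}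

theorem kernel_eq (hf : IsAdmissible f) {t : ℝ} (ht : t ∈ Icc (0 : ℝ) 1) :
    circleKernel f t = f t := by
  rcases ht.2.lt_or_eq with h | rfl
  · rw [circleKernel, Int.fract_eq_self.2 ⟨ht.1, h⟩]
  · rw [circleKernel, Int.fract_one, hf.symm 0 (by simp), sub_zero]

theorem kernel_neg (hf : IsAdmissible f) (t : ℝ) : circleKernel f (-t) = circleKernel f t := by
  have h : circleKernel f (-t) = circleKernel f (1 - Int.fract t) := by
    rw [circleKernel, circleKernel, ← Int.self_sub_floor t, ← sub_add, Int.fract_add_intCast,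
      sub_eq_neg_add, Int.fract_add_one]
  have h0 := Int.fract_nonneg t
  have h1 := Int.fract_lt_one t
  rw [h, hf.kernel_eq ⟨by linarith, by linarith⟩, ← hf.symm _ ⟨h0, h1.le⟩, circleKernel]

theorem kernel_ne_bot (hf : IsAdmissible f) (t : ℝ) : circleKernel f t ≠ ⊥ :=
  hf.ne_bot _ ⟨Int.fract_nonneg t, (Int.fract_lt_one t).le⟩

theorem circleEnergy_ne_bot (hf : IsAdmissible f) (z : ℕ → ℝ) (n : ℕ) (y : ℝ) :
    circleEnergy f z n y ≠ ⊥ :=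
  sum_ne_bot_of_forall _ _ fun _ _ => hf.kernel_ne_bot _

theorem energy_eq (hf : IsAdmissible f) {x : ℕ → ℝ} {n : ℕ} (hx : ∀ k < n, x k ∈ Ico (0 : ℝ) 1)
    {y : ℝ} (hy : y ∈ Ioo (0 : ℝ) 1) : energy f x n y = circleEnergy f x n y := by
  refine Finset.sum_congr rfl fun k hk => ?_
  obtain ⟨h0, h1⟩ := hx k (Finset.mem_range.1 hk)
  have h : |y - x k| ∈ Icc (0 : ℝ) 1 :=
    ⟨abs_nonneg _, abs_le.2 ⟨by linarith [hy.1], by linarith [hy.2]⟩⟩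
  rw [← hf.kernel_eq h]
  rcases abs_choice (y - x k) with h | h <;> rw [h]
  exact hf.kernel_neg _

/-- Strict midpoint convexity on the closed interval, infinite endpoint values included. -/
theorem midpoint_lt (hf : IsAdmissible f) {a b : ℝ} (ha : a ∈ Icc (0 : ℝ) 1)
    (hb : b ∈ Icc (0 : ℝ) 1) (hab : a ≠ b) :
    f ((a + b) / 2) + f ((a + b) / 2) < f a + f b := by
  wlog h : a < b generalizing a b
  · have := this hb ha hab.symm (lt_of_le_of_ne (not_lt.1 h) hab.symm)
    rwa [add_comm a b, add_comm (f a)]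
  have hc : (a + b) / 2 ∈ Ioo (0 : ℝ) 1 := ⟨by linarith [ha.1], by linarith [hb.2]⟩
  have hlt : f ((a + b) / 2) + f ((a + b) / 2) < ⊤ :=
    EReal.add_lt_top (hf.ne_top _ hc) (hf.ne_top _ hc)
  by_cases hta : f a = ⊤
  · rwa [hta, EReal.top_add_of_ne_bot (hf.ne_bot b hb)]
  by_cases htb : f b = ⊤
  · rwa [htb, EReal.add_top_of_ne_bot (hf.ne_bot a ha)]
  have hconv : StrictConvexOn ℝ (Ioo 0 1) fun x => (f x).toReal :=
    strictConvexOn_of_deriv2_pos' (convex_Ioo 0 1) hf.differentiable.continuousOn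
      hf.deriv_deriv_pos
  -- Strictness is only available inside the interval, so compare at the quarter points first.
  have hp : (1 - 1 / 4) * a + 1 / 4 * b ∈ Ioo (0 : ℝ) 1 := by
    constructor <;> linarith [ha.1, hb.2]
  have hq : (1 - 3 / 4) * a + 3 / 4 * b ∈ Ioo (0 : ℝ) 1 := by
    constructor <;> linarith [ha.1, hb.2]
  have h1 := hf.convex a ha b hb (1 / 4) (by norm_num)
  have h2 := hf.convex a ha b hb (3 / 4) (by norm_num)
  have h3 := hconv.2 hp hq (fun h => by linarith) (show (0 : ℝ) < 1 / 2 by norm_num)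
    (show (0 : ℝ) < 1 / 2 by norm_num) (by norm_num)
  have hmid : (1 / 2 : ℝ) • ((1 - 1 / 4) * a + 1 / 4 * b) +
      (1 / 2 : ℝ) • ((1 - 3 / 4) * a + 3 / 4 * b) = (a + b) / 2 := by
    simp only [smul_eq_mul]; ring
  rw [hmid] at h3
  simp only [smul_eq_mul] at h3
  rw [← EReal.coe_toReal hta (hf.ne_bot a ha), ← EReal.coe_toReal htb (hf.ne_bot b hb),
    ← EReal.coe_toReal (hf.ne_top _ hp) (hf.ne_bot _ (Ioo_subset_Icc_self hp))] at h1
  rw [← EReal.coe_toReal hta (hf.ne_bot a ha), ← EReal.coe_toReal htb (hf.ne_bot b hb),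
    ← EReal.coe_toReal (hf.ne_top _ hq) (hf.ne_bot _ (Ioo_subset_Icc_self hq))] at h2
  rw [← EReal.coe_toReal hta (hf.ne_bot a ha), ← EReal.coe_toReal htb (hf.ne_bot b hb),
    ← EReal.coe_toReal (hf.ne_top _ hc) (hf.ne_bot _ (Ioo_subset_Icc_self hc))]
  norm_cast at h1 h2 ⊢
  linarith

/-- The energy of equispaced points is strictly smallest halfway between neighbours. -/
theorem equispaced_energy_lt (hf : IsAdmissible f) {K : ℕ} (hK : 0 < K) {θ : ℝ}
    (hθ : θ ∈ Ico (0 : ℝ) 1) (hne : θ ≠ 1 / 2) :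
    ∑ j ∈ Finset.range K, circleKernel f ((j + 1 / 2) / K) <
      ∑ j ∈ Finset.range K, circleKernel f ((j + θ) / K) := by
  have hK' : (0 : ℝ) < K := by exact_mod_cast hK
  -- Reflecting the circle turns `θ` into `1 - θ`, and `1 / 2` is the midpoint of the two.
  have hrefl : ∑ j ∈ Finset.range K, circleKernel f ((j + (1 - θ)) / K) =
      ∑ j ∈ Finset.range K, circleKernel f ((j + θ) / K) := by
    rw [← Finset.sum_range_reflect]
    refine Finset.sum_congr rfl fun j hj => ?_
    have hj' : j + 1 ≤ K := Finset.mem_range.1 hj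
    rw [← hf.kernel_neg ((j + θ) / K), ← circleKernel_periodic f (-_)]
    congr 1
    rw [Nat.sub_sub, Nat.cast_sub (by omega)]
    push_cast
    field_simp
    ring
  have hsum : ∑ j ∈ Finset.range K,
      (circleKernel f ((j + 1 / 2) / K) + circleKernel f ((j + 1 / 2) / K)) <
      ∑ j ∈ Finset.range K,
        (circleKernel f ((j + θ) / K) + circleKernel f ((j + (1 - θ)) / K)) := by
    obtain ⟨n, rfl⟩ := Nat.exists_eq_add_one.2 hK
    refine sum_range_succ_lt_sum n fun j hj => ?_
    have hj0 : (0 : ℝ) ≤ j := j.cast_nonneg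
    have hj1 : (j : ℝ) + 1 ≤ (n + 1 : ℕ) := by exact_mod_cast Nat.succ_le_succ hj
    have hmem {s : ℝ} (hs : s ∈ Icc (0 : ℝ) 1) : (j + s) / (n + 1 : ℕ) ∈ Icc (0 : ℝ) 1 :=
      ⟨div_nonneg (by linarith [hs.1]) hK'.le, (div_le_one hK').2 (by linarith [hs.2])⟩
    have h1 := hmem (s := θ) ⟨hθ.1, hθ.2.le⟩
    have h2 := hmem (s := 1 - θ) ⟨by linarith [hθ.2], by linarith [hθ.1]⟩
    have h3 := hmem (s := 1 / 2) (by norm_num)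
    rw [hf.kernel_eq h1, hf.kernel_eq h2, hf.kernel_eq h3]
    convert hf.midpoint_lt h1 h2 _ using 3
    · ring
    · ring
    · intro h
      rw [div_left_inj' hK'.ne'] at h
      exact hne (by linarith)
  rw [Finset.sum_add_distrib, Finset.sum_add_distrib, hrefl] at hsum
  by_contra hcon
  exact absurd hsum (not_lt.2 (add_le_add (not_lt.1 hcon) (not_lt.1 hcon)))

theorem circleEnergy_binary (hf : IsAdmissible f) {m : ℕ} {z : ℕ → ℝ} (hz : IsBinary m z) (y : ℝ) :
    circleEnergy f z (2 ^ m) y =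
      ∑ j ∈ Finset.range (2 ^ m), circleKernel f ((j + Int.fract (-2 ^ m * y)) / (2 ^ m : ℕ)) := by
  have hK : (2 : ℝ) ^ m ≠ 0 := by positivity
  have h := sum_range_periodic_shift (2 ^ m)
    (fun n : ℤ => circleKernel f ((n + Int.fract (-2 ^ m * y)) / (2 ^ m : ℕ)))
    (fun n => by
      rw [← circleKernel_periodic f ((n + Int.fract (-2 ^ m * y)) / (2 ^ m : ℕ))]
      congr 1; push_cast; field_simp; ring) ⌊-2 ^ m * y⌋
  have h1 := hz.sum_eq (fun t => circleKernel f (t - y)) fun t => by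
    simp only [add_sub_right_comm t 1, circleKernel_periodic f (t - y)]
  simp only [Int.cast_natCast] at h
  rw [← h]
  trans ∑ k ∈ Finset.range (2 ^ m), circleKernel f (z k - y)
  · refine Finset.sum_congr rfl fun k _ => ?_
    rw [← hf.kernel_neg, neg_sub]
  · rw [h1]
    refine Finset.sum_congr rfl fun j _ => ?_
    congr 1
    rw [Int.fract]
    push_cast
    field_simp
    ring

theorem isCircleMin_binary_iff (hf : IsAdmissible f) {m : ℕ} {z : ℕ → ℝ} (hz : IsBinary m z)
    (y : ℝ) : IsCircleMin f z (2 ^ m) y ↔ ∃ a : ℤ, Odd a ∧ y = a / 2 ^ (m + 1) := by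
  have hK : (2 : ℝ) ^ m ≠ 0 := by positivity
  have hfr : (∃ a : ℤ, Odd a ∧ y = a / 2 ^ (m + 1)) ↔ Int.fract (-2 ^ m * y) = 1 / 2 := by
    constructor
    · rintro ⟨_, ⟨b, rfl⟩, rfl⟩
      refine Int.fract_eq_iff.2 ⟨by norm_num, by norm_num, -b - 1, ?_⟩
      rw [pow_succ]; push_cast; field_simp; ring
    · intro h
      obtain ⟨-, -, n, hn⟩ := Int.fract_eq_iff.1 h
      refine ⟨2 * (-n - 1) + 1, ⟨-n - 1, rfl⟩, ?_⟩
      rw [pow_succ, eq_div_iff (by positivity)]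
      push_cast
      linarith
  rw [hfr]
  constructor
  · intro h
    by_contra hne
    have h1 := hf.equispaced_energy_lt (K := 2 ^ m) (by positivity)
      ⟨Int.fract_nonneg (-2 ^ m * y), Int.fract_lt_one _⟩ hne
    rw [← hf.circleEnergy_binary hz] at h1
    have h2 := h (-(1 / 2) / 2 ^ m)
    rw [hf.circleEnergy_binary hz (-(1 / 2) / 2 ^ m),
      show -2 ^ m * (-(1 / 2) / 2 ^ m) = (1 / 2 : ℝ) by field_simp,
      Int.fract_eq_self.2 ⟨by norm_num, by norm_num⟩] at h2
    exact absurd h1 (not_lt.2 h2)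
  · intro h u
    rw [hf.circleEnergy_binary hz, hf.circleEnergy_binary hz, h]
    by_cases hu : Int.fract (-2 ^ m * u) = 1 / 2
    · rw [hu]
    · exact (hf.equispaced_energy_lt (by positivity)
        ⟨Int.fract_nonneg (-2 ^ m * u), Int.fract_lt_one _⟩ hu).le

theorem circleEnergy_binary_ne_top (hf : IsAdmissible f) {m : ℕ} {z : ℕ → ℝ} (hz : IsBinary m z)
    {y : ℝ} (hy : IsCircleMin f z (2 ^ m) y) : circleEnergy f z (2 ^ m) y ≠ ⊤ := by
  have h1 := hf.equispaced_energy_lt (K := 2 ^ m) (θ := 0) (by positivity) (by simp) (by norm_num)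
  have h2 := hy (-(1 / 2) / 2 ^ m)
  rw [hf.circleEnergy_binary hz (-(1 / 2) / 2 ^ m),
    show -2 ^ m * (-(1 / 2) / 2 ^ m) = (1 / 2 : ℝ) by field_simp,
    Int.fract_eq_self.2 ⟨by norm_num, by norm_num⟩] at h2
  exact (h2.trans_lt (h1.trans_le le_top)).ne

theorem circleEnergy_add (f : ℝ → EReal) (z : ℕ → ℝ) (K k : ℕ) (y : ℝ) :
    circleEnergy f z (K + k) y =
      circleEnergy f z K y + circleEnergy f (fun i => z (K + i) - z K) k (y - z K) := by
  rw [circleEnergy, Finset.sum_range_add]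
  simp only [circleEnergy, sub_sub_sub_cancel_right]

/-! ### Greedy runs are binary -/

theorem odd_div_two_pow_ne_intCast {a : ℤ} (ha : Odd a) (m : ℕ) (j : ℤ) :
    (a : ℝ) / 2 ^ (m + 1) ≠ j := by
  intro h
  rw [div_eq_iff (by positivity)] at h
  have h' : a = j * 2 ^ (m + 1) := by exact_mod_cast h
  rw [pow_succ, ← mul_assoc] at h'
  exact (Int.not_even_iff_odd.2 ha) (h' ▸ even_two.mul_left _)

/-- Greedy runs on the circle are binary, and all minimisers of the energy lie on a dyadic grid.
Once `2 ^ m` points are placed, a new point minimises the sum of two energies: that of these points,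
minimal on the odd multiples of `2 ^ (-(m + 1))`, and that of the remaining ones, whose minimisers
relative to the point with index `2 ^ m` lie on the grid of mesh `2 ^ (-m)` by induction. As that
point is itself an odd multiple of `2 ^ (-(m + 1))`, both terms are minimised simultaneously. -/
theorem circleRun_structure (hf : IsAdmissible f) (m : ℕ) {n : ℕ} (hn : 0 < n) (hnm : n ≤ 2 ^ m)
    {z : ℕ → ℝ} (hz : IsCircleRun f z n) :
    (n < 2 ^ m → (∃ y, IsCircleMin f z n y ∧ circleEnergy f z n y ≠ ⊤) ∧
      ∀ y, IsCircleMin f z n y → (∃ j : ℤ, y = j / 2 ^ m) ∧ ∀ j : ℤ, y ≠ j) ∧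
    (n = 2 ^ m → IsBinary m z) := by
  induction m generalizing n z with
  | zero => exact ⟨fun h => absurd h (by simpa using hn.ne'), fun _ => hz.1⟩
  | succ m ih =>
    have hp : 2 ^ (m + 1) = 2 ^ m + 2 ^ m := by ring
    have h0 : 0 < 2 ^ m := by positivity
    rcases lt_or_ge n (2 ^ m) with hlt | hge
    · refine ⟨fun _ => ?_, fun h => by omega⟩
      obtain ⟨h1, h2⟩ := (ih hn hlt.le hz).1 hlt
      refine ⟨h1, fun y hy => ⟨?_, (h2 y hy).2⟩⟩
      obtain ⟨j, hj⟩ := (h2 y hy).1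
      exact ⟨2 * j, by rw [hj, pow_succ]; push_cast; field_simp⟩
    obtain ⟨i, rfl⟩ := Nat.exists_eq_add_of_le hge
    have hbin : IsBinary m z := (ih h0 le_rfl (hz.mono hge)).2 rfl
    have hgrid {y : ℝ} (hy : IsCircleMin f z (2 ^ m) y) :
        (∃ j : ℤ, y = j / 2 ^ (m + 1)) ∧ ∀ j : ℤ, y ≠ j := by
      obtain ⟨a, ha, rfl⟩ := (hf.isCircleMin_binary_iff hbin y).1 hy
      exact ⟨⟨a, rfl⟩, odd_div_two_pow_ne_intCast ha m⟩
    rcases Nat.eq_zero_or_pos i with rfl | hi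
    · refine ⟨fun _ => ⟨?_, fun y hy => hgrid hy⟩, fun h => by omega⟩
      have hy := (hf.isCircleMin_binary_iff hbin _).2 ⟨1, odd_one, rfl⟩
      exact ⟨_, hy, hf.circleEnergy_binary_ne_top hbin hy⟩
    obtain ⟨a, ha, hza⟩ := (hf.isCircleMin_binary_iff hbin _).1 (hz.2 (2 ^ m) h0 (by omega))
    set w : ℕ → ℝ := fun k => z (2 ^ m + k) - z (2 ^ m) with hw
    have hjoint {k : ℕ} (hk : 0 < k) (hkm : k < 2 ^ m) (hrun : IsCircleRun f w k) :
        (∃ y, IsCircleMin f z (2 ^ m + k) y ∧ circleEnergy f z (2 ^ m + k) y ≠ ⊤) ∧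
        ∀ y, IsCircleMin f z (2 ^ m + k) y →
          IsCircleMin f z (2 ^ m) y ∧ IsCircleMin f w k (y - z (2 ^ m)) := by
      obtain ⟨⟨t, ht, htop⟩, hmem⟩ := (ih hk hkm.le hrun).1 hkm
      obtain ⟨j, hj⟩ := (hmem t ht).1
      have h1 : IsCircleMin f z (2 ^ m) (t + z (2 ^ m)) := by
        refine (hf.isCircleMin_binary_iff hbin _).2 ⟨2 * j + a, (even_two_mul j).add_odd ha, ?_⟩
        rw [hj, hza, pow_succ]; push_cast; field_simp
      have h2 := hf.circleEnergy_binary_ne_top hbin h1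
      have e : circleEnergy f z (2 ^ m + k) (t + z (2 ^ m)) =
          circleEnergy f z (2 ^ m) (t + z (2 ^ m)) + circleEnergy f w k t := by
        rw [circleEnergy_add, add_sub_cancel_right]
      refine ⟨⟨t + z (2 ^ m), fun u => ?_, ?_⟩, fun y hy => ?_⟩
      · rw [e, circleEnergy_add]
        exact add_le_add (h1 u) (ht _)
      · rw [e]
        exact (EReal.add_lt_top h2 htop).ne
      · have h3 := hy (t + z (2 ^ m))
        rw [e, circleEnergy_add] at h3
        obtain ⟨e1, e2⟩ := eq_and_eq_of_add_le_add (h1 y) (ht (y - z (2 ^ m))) h3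
          (hf.circleEnergy_ne_bot _ _ _) (hf.circleEnergy_ne_bot _ _ _) h2 htop
        exact ⟨fun u => e1 ▸ h1 u, fun u => e2.trans_le (ht u)⟩
    have hrun (k : ℕ) (hk : k ≤ i) : IsCircleRun f w k := by
      induction k with
      | zero => exact ⟨by simp [hw], fun j _ hj => absurd hj (by omega)⟩
      | succ k ihk =>
        refine ⟨by simp [hw], fun j h0j hj => ?_⟩
        rcases Nat.lt_succ_iff_lt_or_eq.1 hj with hj | rfl
        · exact (ihk (by omega)).2 j h0j hj
        · exact ((hjoint h0j (by omega) (ihk (by omega))).2 _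
            (hz.2 (2 ^ m + j) (by omega) (by omega))).2
    refine ⟨fun h => ?_, fun h => ⟨hbin, ⟨a, ha, hza⟩, ?_⟩⟩
    · obtain ⟨h1, h2⟩ := hjoint hi (by omega) (hrun i le_rfl)
      exact ⟨h1, fun y hy => hgrid (h2 y hy).1⟩
    · exact (ih hi (by omega) (hrun i le_rfl)).2 (by omega)

theorem exists_isCircleMin (hf : IsAdmissible f) {n : ℕ} (hn : 0 < n) {z : ℕ → ℝ}
    (hz : IsCircleRun f z n) : ∃ y ∈ Ioo (0 : ℝ) 1, IsCircleMin f z n y := by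
  have hlt : n < 2 ^ n := Nat.lt_two_pow_self
  obtain ⟨⟨y, hy, -⟩, h⟩ := (hf.circleRun_structure n hn hlt.le hz).1 hlt
  refine ⟨Int.fract y, ⟨(Int.fract_nonneg y).lt_of_ne fun h0 => ?_, Int.fract_lt_one y⟩,
    fun u => ?_⟩
  · exact (h y hy).2 ⌊y⌋ (by linarith [Int.fract_add_floor y])
  · rw [circleEnergy_fract]
    exact hy u

theorem isGreedyChoice_iff (hf : IsAdmissible f) {n : ℕ} (hn : 0 < n) {x : ℕ → ℝ}
    (hx : ∀ k < n, x k ∈ Ico (0 : ℝ) 1) (hrun : IsCircleRun f x n) (y : ℝ) :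
    IsGreedyChoice f x n y ↔ y ∈ Ioo (0 : ℝ) 1 ∧ IsCircleMin f x n y := by
  refine and_congr_right fun hy => ⟨fun h u => ?_, fun h u hu => ?_⟩
  · obtain ⟨v, hv, hmin⟩ := hf.exists_isCircleMin hn hrun
    have := h v hv
    rw [hf.energy_eq hx hy, hf.energy_eq hx hv] at this
    exact this.trans (hmin u)
  · rw [hf.energy_eq hx hy, hf.energy_eq hx hu]
    exact h u

/-- Minimising over `(0, 1)` amounts to minimising over the circle, as some minimiser over the
circle always differs from `0`. -/
theorem circleRun_of_greedyRun (hf : IsAdmissible f) {N : ℕ} {x : ℕ → ℝ}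
    (h : IsGreedyRun f x N) : IsCircleRun f x N ∧ ∀ k < N, x k ∈ Ico (0 : ℝ) 1 := by
  induction N with
  | zero => exact ⟨⟨h.1, fun k _ hk => absurd hk (by omega)⟩, fun k hk => absurd hk (by omega)⟩
  | succ N ih =>
    obtain ⟨h1, h2⟩ := ih ⟨h.1, fun n h0 hn => h.2 n h0 (by omega)⟩
    rcases Nat.eq_zero_or_pos N with rfl | hN
    · refine ⟨⟨h.1, fun k _ hk => absurd hk (by omega)⟩, fun k hk => ?_⟩
      obtain rfl : k = 0 := by omega
      simp [h.1]
    have h3 := (hf.isGreedyChoice_iff hN h2 h1 _).1 (h.2 N hN (by omega))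
    refine ⟨⟨h.1, fun k h0 hk => ?_⟩, fun k hk => ?_⟩
    · rcases Nat.lt_succ_iff_lt_or_eq.1 hk with hk | rfl
      · exact h1.2 k h0 hk
      · exact h3.2
    · rcases Nat.lt_succ_iff_lt_or_eq.1 hk with hk | rfl
      · exact h2 k hk
      · exact Ioo_subset_Ico_self h3.1

end IsAdmissible

/-! ### The sequence, its permutation and its discrepancy -/

theorem theorem1 (f : ℝ → EReal) (hf : IsAdmissible f) :
    (∀ (x : ℕ → ℝ) (N : ℕ), 0 < N → IsGreedyRun f x N → ∃ y, IsGreedyChoice f x N y) ∧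
    ∀ x : ℕ → ℝ, IsGreedySequence f x →
      ∀ N : ℕ, 0 < N → ∃ m : ℕ, 0 < m ∧ N ≤ 2 ^ m ∧ ∃ σ ∈ permFamily m,
        (∀ k ≤ N, x k = permutedRadicalInverse (2 ^ m) σ k) ∧
        extremeDiscrepancy x N = extremeDiscrepancy (permutedRadicalInverse (2 ^ m) σ) N ∧
        extremeDiscrepancy (permutedRadicalInverse (2 ^ m) σ) N =
          extremeDiscrepancy (radicalInverse 2) N := by

  refine ⟨fun x N hN h => ?_, fun x h N hN => ?_⟩
  · obtain ⟨h1, h2⟩ := hf.circleRun_of_greedyRun h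
    obtain ⟨y, hy, hmin⟩ := hf.exists_isCircleMin hN h1
    exact ⟨y, (hf.isGreedyChoice_iff hN h2 h1 y).2 ⟨hy, hmin⟩⟩
  -- With `m = N` all indices up to and including `N` have a single digit in base `2 ^ m`.
  have hlt : N < 2 ^ N := Nat.lt_two_pow_self
  obtain ⟨hrun, hx⟩ := hf.circleRun_of_greedyRun (N := 2 ^ N) ⟨h.1, fun n h0 _ => h.2 n h0⟩
  have hbin := (hf.circleRun_structure N (by positivity) le_rfl hrun).2 rfl
  obtain ⟨σ, hσ⟩ := hbin.exists_perm
  have hσ0 : σ 0 = 0 := by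
    have h0 := hσ 0
    rw [Fin.val_zero, hbin.zero, Int.fract_zero, eq_comm, div_eq_zero_iff] at h0
    have h1 : ((σ 0 : ℕ) : ℝ) = 0 := h0.resolve_right (by positivity)
    exact Fin.ext (Nat.cast_eq_zero.1 h1)
  have heq (k : ℕ) (hk : k ≤ N) : x k = permutedRadicalInverse (2 ^ N) σ k := by
    have hk' : k < 2 ^ N := hk.trans_lt hlt
    rw [permutedRadicalInverse_of_lt _ σ hσ0 ⟨k, hk'⟩, ← Int.fract_eq_self.2 (hx k hk')]
    exact_mod_cast hσ ⟨k, hk'⟩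
  have hD : extremeDiscrepancy x N = extremeDiscrepancy (permutedRadicalInverse (2 ^ N) σ) N := by
    have hx' (k : ℕ) (hk : k < N) : x k ∈ Ico (0 : ℝ) 1 := hx k (hk.trans hlt)
    rw [extremeDiscrepancy_eq_osc hN hx', extremeDiscrepancy_eq_osc hN fun k hk =>
      heq k hk.le ▸ hx' k hk]
    have : sawtoothSum x N = sawtoothSum (permutedRadicalInverse (2 ^ N) σ) N := by
      ext t
      exact Finset.sum_congr rfl fun k hk => by rw [heq k (Finset.mem_range.1 hk).le]
    rw [sawtoothOsc, sawtoothOsc, this]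
  refine ⟨N, hN, hlt.le, σ, ?_, heq, hD, ?_⟩
  · obtain ⟨m, rfl⟩ := Nat.exists_eq_add_one.2 hN
    exact hbin.mem_permFamily σ hσ
  · rw [← hD, extremeDiscrepancy_eq_osc hN fun k hk => hx k (hk.trans hlt),
      extremeDiscrepancy_eq_osc hN fun k _ => radicalInverse_two_mem k,
      hbin.sawtoothOsc_eq (isBinary_radicalInverse_two N) hlt.le]
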